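/- Let $X$ be a compact metric space, let $\varphi : X \to X$ be a homeomorphism and let $F : X \to \mathbb{R}$ be continuous. Let $C(X)\rtimes_\varphi\mathbb{Z}$ be the crossed product, that is, the universal unital $C^*$-algebra generated by a copy of $C(X)$ and a unitary $U$ such that $UfU^* = f\circ\varphi^{-1}$ for all $f \in C(X)$. Let $\alpha^F = (\alpha^F_t)_{t\in\mathbb{R}}$ be the flow (continuous one-parameter group of $*$-automorphisms) on $C(X)\rtimes_\varphi\mathbb{Z}$ determined by $\alpha^F_t(fU) = fUe^{-itF}$ for all $f\in C(X)$, $t \in \mathbb{R}$. A flow $\alpha$ on a unital $C^*$-algebra $B$ is called inner when there is a self-adjoint element $h\in B$ such that $\alpha_t(a) = e^{ith}ae^{-ith}$ for all $a\in B$ and $t\in\mathbb{R}$. Then the following conditions are equivalent: 1. The flow $\alpha^F$ is inner. 2. There is a real-valued function $h\in C(X)$ such that $\alpha^F_t = \operatorname{Ad} e^{ith}$ for all $t\in\mathbb{R}$, i.e. $\alpha^F_t(a) = e^{ith}ae^{-ith}$ for all $a \in C(X)\rtimes_\varphi\mathbb{Z}$ and $t \in \mathbb{R}$. 3. There is a continuous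 function $h : X\to\mathbb{R}$ such that $F = h\circ\varphi - h$. -/

import Mathlib

noncomputable section

namespace ZCrossedProduct

universe u v

/-! ## The algebraic crossed product of `C(X)` by `ℤ` -/

section Algebraic

variable {X : Type u} [TopologicalSpace X] [CompactSpace X]

/-- The algebra `C(X)`, regarded as carrying the action of `ℤ` defined by the homeomorphism `φ`
(a type synonym of `C(X, ℂ)`). -/
def Coef (_φ : X ≃ₜ X) : Type u := C(X, ℂ)

instance (φ : X ≃ₜ X) : CommCStarAlgebra (Coef φ) :=
  inferInstanceAs (CommCStarAlgebra C(X, ℂ))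

/-- The identity map of `C(X)` to its type synonym. -/
def toCoef (φ : X ≃ₜ X) : C(X, ℂ) ≃⋆ₐ[ℂ] Coef φ where
  __ := Equiv.refl C(X, ℂ)
  map_mul' _ _ := rfl
  map_add' _ _ := rfl
  map_star' _ := rfl
  map_smul' _ _ := rfl

/-- The integer `n` acts on `C(X)` by `f ↦ f ∘ φ⁻ⁿ`. -/
instance (φ : X ≃ₜ X) : MulSemiringAction (Multiplicative ℤ) (Coef φ) where
  smul n f := ContinuousMap.comp f ((φ ^ (-n.toAdd) : X ≃ₜ X) : C(X, X))
  one_smul _ := rfl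
  mul_smul m n f := by
    change C(X, ℂ) at f
    refine ContinuousMap.ext fun x => ?_
    change (f : C(X, ℂ)) ((φ ^ (-(m.toAdd + n.toAdd)) : X ≃ₜ X) x) =
      (f : C(X, ℂ)) ((φ ^ (-n.toAdd) : X ≃ₜ X) ((φ ^ (-m.toAdd) : X ≃ₜ X) x))
    rw [neg_add_rev, zpow_add]
    rfl
  smul_zero _ := rfl
  smul_add _ _ _ := rfl
  smul_one _ := rfl
  smul_mul _ _ _ := rfl

instance (φ : X ≃ₜ X) : SMulCommClass (Multiplicative ℤ) ℂ (Coef φ) where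
  smul_comm _ _ _ := rfl

theorem smul_star_coef {φ : X ≃ₜ X} (n : Multiplicative ℤ) (f : Coef φ) :
    n • star f = star (n • f) := rfl

theorem smul_toCoef {φ : X ≃ₜ X} (n : Multiplicative ℤ) (f : C(X, ℂ)) :
    n • toCoef φ f = toCoef φ (f.comp ((φ ^ (-n.toAdd) : X ≃ₜ X) : C(X, X))) := rfl

theorem norm_toCoef {φ : X ≃ₜ X} (f : C(X, ℂ)) : ‖toCoef φ f‖ = ‖f‖ := rfl

theorem norm_smul_coef_le {φ : X ≃ₜ X} (n : Multiplicative ℤ) (f : Coef φ) :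
    ‖n • f‖ ≤ ‖f‖ := by
  refine (ContinuousMap.norm_le (α := X) (E := ℂ) (n • f : Coef φ) (norm_nonneg f)).2 fun x => ?_
  exact ContinuousMap.norm_coe_le_norm (α := X) (E := ℂ) f _

/-- Finite sums `∑ fₙ Uⁿ` with `fₙ ∈ C(X)`, multiplied by the rule `U f = (f ∘ φ⁻¹) U`;
`SkewMonoidAlgebra.single n f` is the monomial `f Uⁿ`. -/
abbrev Alg (φ : X ≃ₜ X) : Type u := SkewMonoidAlgebra (Coef φ) (Multiplicative ℤ)

open SkewMonoidAlgebra

variable {φ : X ≃ₜ X}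

/-- The involution of `Alg φ` as an additive map: `(f Uⁿ)* = U⁻ⁿ f̄ = (f̄ ∘ φⁿ) U⁻ⁿ`. -/
def starAddHom (φ : X ≃ₜ X) : Alg φ →+ Alg φ where
  toFun a := a.sum fun n f => single n⁻¹ (n⁻¹ • star f)
  map_zero' := sum_zero_index
  map_add' a b := sum_add_index' (by simp) (by simp)

theorem starAddHom_single (n : Multiplicative ℤ) (f : Coef φ) :
    starAddHom φ (single n f) = single n⁻¹ (n⁻¹ • star f) :=
  sum_single_index (h := fun n (f : Coef φ) => (single n⁻¹ (n⁻¹ • star f) : Alg φ)) (by simp)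

theorem alg_induction {p : Alg φ → Prop} (a : Alg φ) (h0 : p 0)
    (hs : ∀ n f, p (single n f)) (ha : ∀ a b, p a → p b → p (a + b)) : p a :=
  SkewMonoidAlgebra.induction_on a h0 hs ha

instance : StarRing (Alg φ) where
  star := starAddHom φ
  star_involutive a := by
    induction a using alg_induction with
    | h0 => simp
    | hs n f =>
      rw [starAddHom_single, starAddHom_single, ← smul_star_coef]; simp
    | ha a b h1 h2 =>
      change starAddHom φ (starAddHom φ _) = _ at h1 h2
      rw [map_add, map_add, h1, h2]
  star_add a b := map_add (starAddHom φ) a b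
  star_mul a b := by
    change starAddHom φ (a * b) = starAddHom φ b * starAddHom φ a
    induction a using alg_induction with
    | h0 => simp
    | ha a a' h1 h2 => rw [add_mul, map_add, map_add, h1, h2, mul_add]
    | hs n f =>
      induction b using alg_induction with
      | h0 => simp
      | ha a a' h1 h2 => rw [mul_add, map_add, map_add, h1, h2, add_mul]
      | hs m g =>
        rw [single_mul_single, starAddHom_single, starAddHom_single, starAddHom_single,
          single_mul_single, mul_inv_rev, star_mul, ← smul_star_coef, smul_mul', mul_smul,
          mul_smul, inv_smul_smul]

theorem star_single (n : Multiplicative ℤ) (f : Coef φ) :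
    star (single n f : Alg φ) = single n⁻¹ (n⁻¹ • star f) := starAddHom_single n f

instance : StarModule ℂ (Alg φ) where
  star_smul c a := by
    induction a using alg_induction with
    | h0 => simp
    | hs n f =>
      rw [smul_single, star_single, star_single, star_smul, smul_single, smul_comm]
    | ha a b h1 h2 => simp [smul_add, h1, h2]

/-! ## The universal C⋆-norm -/

/-- `p` is a C⋆-seminorm on `Alg φ`, normalised so that `p (f Uⁿ) ≤ ‖f‖`. Every ⋆-homomorphism
of `Alg φ` into a C⋆-algebra defines such a `p`. -/
structure IsCStarSeminorm (p : Seminorm ℂ (Alg φ)) : Prop where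
  mul_le : ∀ a b, p (a * b) ≤ p a * p b
  star_mul_self : ∀ a, p (star a * a) = p a * p a
  single_le : ∀ n f, p (single n f) ≤ ‖f‖

/-- The type of C⋆-seminorms. -/
abbrev CStarSeminorms (φ : X ≃ₜ X) : Type u := {p : Seminorm ℂ (Alg φ) // IsCStarSeminorm p}

instance : Nonempty (CStarSeminorms φ) :=
  ⟨0, ⟨by simp, by simp, by simp⟩⟩

/-- The universal norm: the supremum of all C⋆-seminorms. -/
def uNorm (a : Alg φ) : ℝ := ⨆ p : CStarSeminorms φ, p.1 a

theorem bddAbove_seminorms (a : Alg φ) :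
    BddAbove (Set.range fun p : CStarSeminorms φ => p.1 a) := by
  induction a using alg_induction with
  | h0 => exact ⟨0, by rintro _ ⟨p, rfl⟩; simp⟩
  | hs n f => exact ⟨‖f‖, by rintro _ ⟨p, rfl⟩; exact p.2.single_le n f⟩
  | ha a b h1 h2 =>
    obtain ⟨M, hM⟩ := h1
    obtain ⟨N, hN⟩ := h2
    refine ⟨M + N, ?_⟩
    rintro _ ⟨p, rfl⟩
    exact (map_add_le_add p.1 a b).trans (add_le_add (hM ⟨p, rfl⟩) (hN ⟨p, rfl⟩))

theorem le_uNorm (p : CStarSeminorms φ) (a : Alg φ) : p.1 a ≤ uNorm a :=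
  le_ciSup (bddAbove_seminorms a) p

theorem uNorm_nonneg (a : Alg φ) : 0 ≤ uNorm a :=
  Real.iSup_nonneg fun p => apply_nonneg p.1 a

theorem uNorm_mul_le (a b : Alg φ) : uNorm (a * b) ≤ uNorm a * uNorm b :=
  ciSup_le fun p => (p.2.mul_le a b).trans
    (mul_le_mul (le_uNorm p a) (le_uNorm p b) (apply_nonneg _ _) (uNorm_nonneg _))

theorem uNorm_single_le (n : Multiplicative ℤ) (f : Coef φ) :
    uNorm (single n f : Alg φ) ≤ ‖f‖ := ciSup_le fun p => p.2.single_le n f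

theorem uNorm_mul_self_le (a : Alg φ) : uNorm a * uNorm a ≤ uNorm (star a * a) := by
  have h : uNorm a ≤ √(uNorm (star a * a)) := ciSup_le fun p =>
    Real.le_sqrt_of_sq_le (by rw [sq, ← p.2.star_mul_self]; exact le_uNorm p _)
  exact (mul_self_le_mul_self (uNorm_nonneg a) h).trans_eq (Real.mul_self_sqrt (uNorm_nonneg _))

/-- The universal norm as a bundled seminorm of the additive group. -/
def uSeminorm (φ : X ≃ₜ X) : AddGroupSeminorm (Alg φ) where
  toFun := uNorm
  map_zero' := by simp [uNorm]
  add_le' a b := ciSup_le fun p => (map_add_le_add p.1 a b).trans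
    (add_le_add (le_uNorm p a) (le_uNorm p b))
  neg' a := by simp [uNorm]

instance : SeminormedAddCommGroup (Alg φ) := (uSeminorm φ).toSeminormedAddCommGroup

instance : SeminormedRing (Alg φ) where
  __ := (inferInstance : SeminormedAddCommGroup (Alg φ))
  __ := (inferInstance : Ring (Alg φ))
  norm_mul_le := uNorm_mul_le

theorem norm_alg (a : Alg φ) : ‖a‖ = uNorm a := rfl

instance : NormedSpace ℂ (Alg φ) where
  norm_smul_le c a := ciSup_le fun p => by
    rw [map_smul_eq_mul]
    exact mul_le_mul_of_nonneg_left (le_uNorm p a) (norm_nonneg c)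

instance : NormedAlgebra ℂ (Alg φ) where
  norm_smul_le := norm_smul_le

theorem norm_le_norm_star (a : Alg φ) : ‖a‖ ≤ ‖star a‖ := by
  have h : ‖a‖ * ‖a‖ ≤ ‖star a‖ * ‖a‖ := (uNorm_mul_self_le a).trans (uNorm_mul_le _ _)
  rcases (norm_nonneg a).eq_or_lt with h0 | h0
  · rw [← h0]; exact norm_nonneg _
  · exact le_of_mul_le_mul_right h h0

instance : NormedStarGroup (Alg φ) where
  norm_star_le a := by simpa using norm_le_norm_star (star a)

theorem uniformContinuous_star_alg : UniformContinuous (star : Alg φ → Alg φ) :=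
  uniformContinuous_addMonoidHom_of_continuous (f := starAddHom φ) continuous_star

end Algebraic

/-! ## The crossed product C⋆-algebra -/

section CrossedProduct

variable {X : Type u} [TopologicalSpace X] [CompactSpace X]

open SkewMonoidAlgebra UniformSpace

/-- The crossed product C⋆-algebra `C(X) ⋊_φ ℤ`: the (Hausdorff) completion of the algebraic
crossed product in the universal C⋆-norm. -/
def CrossedProduct (φ : X ≃ₜ X) : Type u := Completion (Alg φ)

variable {φ : X ≃ₜ X}

instance : NormedRing (CrossedProduct φ) := inferInstanceAs (NormedRing (Completion (Alg φ)))

instance : CompleteSpace (CrossedProduct φ) := inferInstanceAs (CompleteSpace (Completion (Alg φ)))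

instance : Algebra ℂ (CrossedProduct φ) := inferInstanceAs (Algebra ℂ (Completion (Alg φ)))

instance : NormedAlgebra ℂ (CrossedProduct φ) where
  norm_smul_le := norm_smul_le (α := ℂ) (β := Completion (Alg φ))

/-- The canonical map of the algebraic crossed product into the crossed product. -/
def toCP (φ : X ≃ₜ X) : Alg φ →ₐ[ℂ] CrossedProduct φ where
  __ := (Completion.coeRingHom : Alg φ →+* Completion (Alg φ))
  commutes' _ := rfl

theorem norm_toCP (a : Alg φ) : ‖toCP φ a‖ = ‖a‖ := Completion.norm_coe a

theorem continuous_toCP : Continuous (toCP φ) := Completion.continuous_coe (Alg φ)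

theorem denseRange_toCP : DenseRange (toCP φ) := Completion.denseRange_coe

theorem cp_induction {p : CrossedProduct φ → Prop} (x : CrossedProduct φ)
    (hp : IsClosed {x | p x}) (h : ∀ a, p (toCP φ a)) : p x :=
  denseRange_toCP.induction_on x hp h

instance : Star (CrossedProduct φ) where
  star := Completion.map (star : Alg φ → Alg φ)

theorem star_toCP (a : Alg φ) : star (toCP φ a) = toCP φ (star a) :=
  Completion.map_coe uniformContinuous_star_alg a

theorem continuous_star_cp : Continuous (star : CrossedProduct φ → CrossedProduct φ) :=
  Completion.continuous_map

instance : StarRing (CrossedProduct φ) where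
  star_involutive x := by
    induction x using cp_induction with
    | hp => exact isClosed_eq (continuous_star_cp.comp continuous_star_cp) continuous_id
    | h a => rw [star_toCP, star_toCP, star_star]
  star_add x y := by
    induction x using cp_induction with
    | hp =>
      exact isClosed_eq (continuous_star_cp.comp (continuous_id.add continuous_const))
        (continuous_star_cp.add continuous_const)
    | h a =>
      induction y using cp_induction with
      | hp =>
        exact isClosed_eq (continuous_star_cp.comp (continuous_const.add continuous_id))
          (continuous_const.add continuous_star_cp)
      | h b => rw [← map_add, star_toCP, star_toCP, star_toCP, star_add, map_add]
  star_mul x y := by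
    induction x using cp_induction with
    | hp =>
      exact isClosed_eq (continuous_star_cp.comp (continuous_id.mul continuous_const))
        (continuous_const.mul continuous_star_cp)
    | h a =>
      induction y using cp_induction with
      | hp =>
        exact isClosed_eq (continuous_star_cp.comp (continuous_const.mul continuous_id))
          (continuous_star_cp.mul continuous_const)
      | h b => rw [← map_mul, star_toCP, star_toCP, star_toCP, star_mul, map_mul]

instance : StarModule ℂ (CrossedProduct φ) where
  star_smul c x := by
    induction x using cp_induction with
    | hp =>
      exact isClosed_eq (continuous_star_cp.comp (continuous_const_smul c))
        (continuous_star_cp.const_smul (star c))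
    | h a => rw [← map_smul, star_toCP, star_toCP, star_smul, map_smul]

instance : CStarRing (CrossedProduct φ) where
  norm_mul_self_le x := by
    induction x using cp_induction with
    | hp =>
      exact isClosed_le (continuous_norm.mul continuous_norm)
        ((continuous_star_cp.mul continuous_id).norm)
    | h a =>
      rw [star_toCP, ← map_mul, norm_toCP, norm_toCP]
      exact uNorm_mul_self_le a

instance : CStarAlgebra (CrossedProduct φ) where

/-- The canonical map `C(X) → C(X) ⋊_φ ℤ`. -/
def ofFun (φ : X ≃ₜ X) : C(X, ℂ) →⋆ₐ[ℂ] CrossedProduct φ where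
  toFun f := toCP φ (single 1 (toCoef φ f))
  map_one' := by rw [map_one, single_one_one, map_one]
  map_mul' f g := by
    rw [← map_mul (toCP φ), single_mul_single, one_smul, one_mul, map_mul]
  map_zero' := by rw [map_zero, single_zero, map_zero]
  map_add' f g := by rw [← map_add (toCP φ), ← single_add, map_add]
  commutes' c := (toCP φ).commutes c
  map_star' f := by
    rw [star_toCP, star_single, inv_one, one_smul, map_star]

theorem ofFun_apply (f : C(X, ℂ)) : ofFun φ f = toCP φ (single 1 (toCoef φ f)) := rfl

theorem toCP_single_mem_unitary (n : Multiplicative ℤ) :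
    toCP φ (single n 1) ∈ unitary (CrossedProduct φ) := by
  rw [Unitary.mem_iff, star_toCP, star_single, ← map_mul, ← map_mul, single_mul_single,
    single_mul_single]
  simp

/-- The canonical unitary `U` of `C(X) ⋊_φ ℤ`. -/
def U (φ : X ≃ₜ X) : unitary (CrossedProduct φ) :=
  ⟨toCP φ (single (Multiplicative.ofAdd 1) 1), toCP_single_mem_unitary _⟩

theorem coe_U : (U φ : CrossedProduct φ) = toCP φ (single (Multiplicative.ofAdd 1) 1) := rfl

/-- The defining relation `U f U* = f ∘ φ⁻¹`. -/
theorem U_mul_ofFun_mul_star (f : C(X, ℂ)) :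
    (U φ : CrossedProduct φ) * ofFun φ f * star (U φ : CrossedProduct φ) =
      ofFun φ (f.comp (φ.symm : C(X, X))) := by
  rw [coe_U, ofFun_apply, star_toCP, star_single, ← map_mul, ← map_mul, single_mul_single,
    single_mul_single]
  simp
  rfl

theorem coe_U_zpow (n : ℤ) :
    ((U φ ^ n : unitary (CrossedProduct φ)) : CrossedProduct φ) =
      toCP φ (single (Multiplicative.ofAdd n) 1) := by
  let g : Multiplicative ℤ →* unitary (CrossedProduct φ) :=
    { toFun := fun n => ⟨toCP φ (single n 1), toCP_single_mem_unitary n⟩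
      map_one' := Subtype.ext (map_one (toCP φ))
      map_mul' := fun m n => Subtype.ext <| by
        change toCP φ (single (m * n) 1) = toCP φ (single m 1) * toCP φ (single n 1)
        rw [← map_mul, single_mul_single, smul_one, one_mul] }
  have h : U φ ^ n = g (Multiplicative.ofAdd n) := by
    have : U φ = g (Multiplicative.ofAdd 1) := rfl
    rw [this, ← map_zpow, ← ofAdd_zsmul, smul_eq_mul, mul_one]
  rw [h]
  rfl

theorem toCP_single (n : Multiplicative ℤ) (f : C(X, ℂ)) :
    toCP φ (single n (toCoef φ f)) =
      ofFun φ f * ((U φ ^ n.toAdd : unitary (CrossedProduct φ)) : CrossedProduct φ) := by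
  rw [coe_U_zpow, ofFun_apply, ← map_mul, single_mul_single]
  simp

theorem norm_ofFun_le (f : C(X, ℂ)) : ‖ofFun φ f‖ ≤ ‖f‖ := by
  rw [ofFun_apply, norm_toCP]
  exact uNorm_single_le _ _

/-! ## The universal property -/

section Universal

variable {B : Type v} [CStarAlgebra B]

/-- A covariant pair: a unital ⋆-homomorphism `π : C(X) → B` and a unitary `V` of `B` with
`V π(f) V* = π(f ∘ φ⁻¹)`. -/
def IsCovariant (φ : X ≃ₜ X) (π : C(X, ℂ) →⋆ₐ[ℂ] B) (V : unitary B) : Prop :=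
  ∀ f : C(X, ℂ), (V : B) * π f * star (V : B) = π (f.comp (φ.symm : C(X, X)))

variable {π : C(X, ℂ) →⋆ₐ[ℂ] B} {V : unitary B}

theorem IsCovariant.conj_zpow (h : IsCovariant φ π V) (n : ℤ) (f : C(X, ℂ)) :
    ((V ^ n : unitary B) : B) * π f =
      π (f.comp ((φ ^ (-n) : X ≃ₜ X) : C(X, X))) * ((V ^ n : unitary B) : B) := by
  have h1 : ∀ g, (V : B) * π g = π (g.comp (φ.symm : C(X, X))) * V := fun g => by
    rw [← h g, mul_assoc, Unitary.coe_star_mul_self, mul_one]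
  have h2 : ∀ g, star (V : B) * π g = π (g.comp (φ : C(X, X))) * star (V : B) := fun g => by
    have := h (g.comp (φ : C(X, X)))
    rw [ContinuousMap.comp_assoc, Homeomorph.toContinuousMap_comp_symm,
      ContinuousMap.comp_id] at this
    rw [← this, ← mul_assoc, ← mul_assoc, Unitary.coe_star_mul_self, one_mul]
  induction n generalizing f with
  | zero => simp; rfl
  | succ n ih =>
    rw [zpow_add_one, Submonoid.coe_mul, mul_assoc, h1, ← mul_assoc, ih, mul_assoc]
    congr 2
    refine ContinuousMap.ext fun x => congrArg f ?_
    rw [neg_add_rev, zpow_add, zpow_neg_one]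
    rfl
  | pred n ih =>
    rw [zpow_sub_one, Submonoid.coe_mul, mul_assoc, ← Unitary.star_eq_inv, Unitary.coe_star, h2,
      ← mul_assoc, ih, mul_assoc]
    congr 2
    refine ContinuousMap.ext fun x => congrArg f ?_
    rw [neg_sub', sub_neg_eq_add, add_comm, zpow_add, zpow_one]
    rfl

/-- The homomorphism `∑ fₙ Uⁿ ↦ ∑ π(fₙ) Vⁿ` of the algebraic crossed product defined by a
covariant pair. -/
def liftAlgHom (h : IsCovariant φ π V) : Alg φ →ₐ[ℂ] B :=
  liftNCAlgHom (π.toAlgHom.comp (toCoef φ).symm.toStarAlgHom.toAlgHom)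
    ((unitary B).subtype.comp (zpowersHom (unitary B) V))
    (fun {f n} => (h.conj_zpow n.toAdd ((toCoef φ).symm f)).symm)

theorem liftAlgHom_single (h : IsCovariant φ π V) (n : Multiplicative ℤ) (f : C(X, ℂ)) :
    liftAlgHom h (single n (toCoef φ f)) = π f * ((V ^ n.toAdd : unitary B) : B) :=
  SkewMonoidAlgebra.liftNC_single _ _ _ _

theorem toCoef_surjective (f : Coef φ) : ∃ g, toCoef φ g = f := ⟨f, rfl⟩

/-- `liftAlgHom` as a ⋆-homomorphism. -/
def liftAlg (h : IsCovariant φ π V) : Alg φ →⋆ₐ[ℂ] B where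
  __ := liftAlgHom h
  map_star' a := by
    change liftAlgHom h (star a) = star (liftAlgHom h a)
    induction a using alg_induction with
    | h0 => simp
    | hs n f =>
      obtain ⟨f, rfl⟩ := toCoef_surjective f
      rw [star_single, ← map_star, smul_toCoef, liftAlgHom_single, liftAlgHom_single, star_mul,
        ← map_star, toAdd_inv, ← h.conj_zpow, zpow_neg, ← Unitary.star_eq_inv, Unitary.coe_star]
    | ha a b h1 h2 => rw [star_add, map_add, map_add, star_add, h1, h2]

theorem liftAlg_single (h : IsCovariant φ π V) (n : Multiplicative ℤ) (f : C(X, ℂ)) :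
    liftAlg h (single n (toCoef φ f)) = π f * ((V ^ n.toAdd : unitary B) : B) :=
  liftAlgHom_single h n f

theorem norm_liftAlg_le (h : IsCovariant φ π V) (a : Alg φ) : ‖liftAlg h a‖ ≤ ‖a‖ := by
  let p : Seminorm ℂ (Alg φ) := (normSeminorm ℂ B).comp (liftAlg h).toAlgHom.toLinearMap
  have hp : ∀ a, p a = ‖liftAlg h a‖ := fun _ => rfl
  refine le_uNorm ⟨p, ⟨fun a b => ?_, fun a => ?_, fun n f => ?_⟩⟩ a
  · rw [hp, hp, hp, map_mul]; exact norm_mul_le _ _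
  · rw [hp, hp, map_mul, map_star]; exact CStarRing.norm_star_mul_self
  · rw [hp]
    obtain ⟨f, rfl⟩ := toCoef_surjective f
    rw [liftAlg_single, CStarRing.norm_mul_coe_unitary, norm_toCoef]
    exact NonUnitalStarAlgHom.norm_apply_le π f

theorem uniformContinuous_liftAlg (h : IsCovariant φ π V) : UniformContinuous (liftAlg h) :=
  (AddMonoidHomClass.lipschitz_of_bound (liftAlg h) 1
    fun a => by simpa using norm_liftAlg_le h a).uniformContinuous

/-- The ring homomorphism extending `liftAlg h` to `C(X) ⋊_φ ℤ`. -/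
def liftRingHom (h : IsCovariant φ π V) : CrossedProduct φ →+* B :=
  Completion.extensionHom (liftAlg h).toAlgHom.toRingHom (uniformContinuous_liftAlg h).continuous

theorem continuous_liftRingHom (h : IsCovariant φ π V) : Continuous (liftRingHom h) :=
  Completion.continuous_extension

theorem liftRingHom_toCP (h : IsCovariant φ π V) (a : Alg φ) :
    liftRingHom h (toCP φ a) = liftAlg h a :=
  Completion.extensionHom_coe _ (uniformContinuous_liftAlg h).continuous a

/-- The ⋆-homomorphism `C(X) ⋊_φ ℤ → B` defined by a covariant pair. -/
def lift (h : IsCovariant φ π V) : CrossedProduct φ →⋆ₐ[ℂ] B where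
  __ := liftRingHom h
  commutes' c := by
    change liftRingHom h (algebraMap ℂ _ c) = _
    rw [← (toCP φ).commutes c, liftRingHom_toCP, AlgHomClass.commutes]
  map_star' x := by
    change liftRingHom h (star x) = star (liftRingHom h x)
    induction x using cp_induction with
    | hp =>
      exact isClosed_eq ((continuous_liftRingHom h).comp continuous_star_cp)
        (continuous_liftRingHom h).star
    | h a => rw [star_toCP, liftRingHom_toCP, liftRingHom_toCP, map_star]

theorem lift_toCP (h : IsCovariant φ π V) (a : Alg φ) : lift h (toCP φ a) = liftAlg h a :=
  liftRingHom_toCP h a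

theorem lift_ofFun (h : IsCovariant φ π V) (f : C(X, ℂ)) : lift h (ofFun φ f) = π f := by
  rw [ofFun_apply, lift_toCP, liftAlg_single]; simp

theorem lift_U (h : IsCovariant φ π V) : lift h (U φ : CrossedProduct φ) = V := by
  rw [coe_U, lift_toCP, ← map_one (toCoef φ), liftAlg_single]; simp

theorem continuous_hom (ρ : CrossedProduct φ →⋆ₐ[ℂ] B) : Continuous ρ :=
  (AddMonoidHomClass.lipschitz_of_bound ρ 1
    fun a => by simpa using NonUnitalStarAlgHom.norm_apply_le ρ a).continuous

/-- The homomorphism of unitary groups induced by a ⋆-homomorphism. -/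
def unitaryMap {A : Type*} [CStarAlgebra A] (ρ : A →⋆ₐ[ℂ] B) : unitary A →* unitary B where
  toFun u := ⟨ρ u, Unitary.map_mem ρ u.2⟩
  map_one' := Subtype.ext (map_one ρ)
  map_mul' _ _ := Subtype.ext (map_mul ρ _ _)

/-- The image under `ρ` of a monomial. -/
theorem hom_toCP_single (ρ : CrossedProduct φ →⋆ₐ[ℂ] B) (W : unitary B)
    (hW : ρ (U φ : CrossedProduct φ) = W) (n : Multiplicative ℤ) (f : C(X, ℂ)) :
    ρ (toCP φ (single n (toCoef φ f))) = ρ (ofFun φ f) * ((W ^ n.toAdd : unitary B) : B) := by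
  have h : unitaryMap ρ (U φ) = W := Subtype.ext hW
  rw [toCP_single, map_mul, ← h, ← map_zpow]
  rfl

theorem hom_ext {ρ σ : CrossedProduct φ →⋆ₐ[ℂ] B} (h1 : ∀ f, ρ (ofFun φ f) = σ (ofFun φ f))
    (h2 : ρ (U φ : CrossedProduct φ) = σ (U φ : CrossedProduct φ)) : ρ = σ := by
  ext x
  induction x using cp_induction with
  | hp => exact isClosed_eq (continuous_hom ρ) (continuous_hom σ)
  | h a =>
    induction a using alg_induction with
    | h0 => simp
    | hs n f =>
      obtain ⟨f, rfl⟩ := toCoef_surjective f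
      rw [hom_toCP_single ρ (unitaryMap σ (U φ)) h2, hom_toCP_single σ (unitaryMap σ (U φ)) rfl,
        h1]
    | ha a b h1 h2 => rw [map_add, map_add, map_add, h1, h2]

/-- The universal property of `C(X) ⋊_φ ℤ`. -/
theorem existsUnique_lift (h : IsCovariant φ π V) :
    ∃! ρ : CrossedProduct φ →⋆ₐ[ℂ] B,
      (∀ f, ρ (ofFun φ f) = π f) ∧ ρ (U φ : CrossedProduct φ) = V :=
  ⟨lift h, ⟨lift_ofFun h, lift_U h⟩, fun _ hρ => hom_ext
    (fun f => (hρ.1 f).trans (lift_ofFun h f).symm) (hρ.2.trans (lift_U h).symm)⟩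

end Universal

end CrossedProduct

/-! ## Flows -/

section Flows

open SkewMonoidAlgebra

/-- A flow on a unital C⋆-algebra: a (strongly) continuous one-parameter group of
⋆-automorphisms. -/
structure CStarFlow (B : Type v) [CStarAlgebra B] where
  /-- The automorphism at time `t`. -/
  aut : ℝ → (B ≃⋆ₐ[ℂ] B)
  aut_zero : ∀ a, aut 0 a = a
  aut_add : ∀ s t a, aut (s + t) a = aut s (aut t a)
  continuous_aut : ∀ a, Continuous fun t => aut t a

/-- `αₜ = Ad e^{ith}` for all real `t`, that is `αₜ(a) = e^{ith} a e^{-ith}` for all `a`. -/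
def CStarFlow.ImplementedBy {B : Type v} [CStarAlgebra B] (α : CStarFlow B) (h : B) : Prop :=
  ∀ (t : ℝ) (a : B), α.aut t a =
    NormedSpace.exp ((Complex.I * t) • h) * a * NormedSpace.exp (-((Complex.I * t) • h))

/-- A flow is inner when it is of the form `Ad e^{ith}` for a self-adjoint element `h`. -/
def CStarFlow.IsInner {B : Type v} [CStarAlgebra B] (α : CStarFlow B) : Prop :=
  ∃ h : B, IsSelfAdjoint h ∧ α.ImplementedBy h

variable {X : Type u} [TopologicalSpace X] [CompactSpace X]

/-- A real-valued continuous function as an element of `C(X)`. -/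
def toComplex (h : C(X, ℝ)) : C(X, ℂ) := ⟨fun x => (h x : ℂ), by fun_prop⟩

/-- The function `e^{-itF}`, an element of `C(X)`. -/
def phase (F : C(X, ℝ)) (t : ℝ) : C(X, ℂ) :=
  ⟨fun x => Complex.exp (-(Complex.I * t * F x)), by fun_prop⟩

theorem phase_zero (F : C(X, ℝ)) : phase F 0 = 1 := by
  ext x; simp [phase]

theorem phase_add (F : C(X, ℝ)) (s t : ℝ) : phase F (s + t) = phase F s * phase F t := by
  ext x
  simp only [phase, ContinuousMap.coe_mk, ContinuousMap.mul_apply, ← Complex.exp_add]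
  congr 1
  push_cast
  ring

theorem star_phase (F : C(X, ℝ)) (t : ℝ) : star (phase F t) = phase F (-t) := by
  ext x
  simp [phase, ← Complex.exp_conj]

theorem continuous_phase (F : C(X, ℝ)) : Continuous (phase F) := by
  refine ContinuousMap.continuous_of_continuous_uncurry _ ?_
  simp only [phase, Function.uncurry_def, ContinuousMap.coe_mk]
  fun_prop

/-- `e^{-itF}` as a unitary of `C(X)`. -/
def phaseUnitary (F : C(X, ℝ)) (t : ℝ) : unitary C(X, ℂ) :=
  ⟨phase F t, by
    rw [Unitary.mem_iff, star_phase, ← phase_add, ← phase_add]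
    simp [phase_zero]⟩

variable (φ : X ≃ₜ X) (F : C(X, ℝ))

/-- The unitary `U e^{-itF}` of the crossed product. -/
def twistedU (t : ℝ) : unitary (CrossedProduct φ) :=
  U φ * unitaryMap (ofFun φ) (phaseUnitary F t)

theorem coe_twistedU (t : ℝ) : (twistedU φ F t : CrossedProduct φ) =
    (U φ : CrossedProduct φ) * ofFun φ (phase F t) := rfl

theorem isCovariant_twistedU (t : ℝ) : IsCovariant φ (ofFun φ) (twistedU φ F t) := by
  intro f
  rw [coe_twistedU, star_mul, ← map_star, ← U_mul_ofFun_mul_star]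
  have : ofFun φ (phase F t) * ofFun φ f * ofFun φ (star (phase F t)) = ofFun φ f := by
    rw [← map_mul, ← map_mul, mul_right_comm, star_phase, ← phase_add, add_neg_cancel, phase_zero,
      one_mul]
  calc _ = (U φ : CrossedProduct φ) *
        (ofFun φ (phase F t) * ofFun φ f * ofFun φ (star (phase F t))) *
        star (U φ : CrossedProduct φ) := by simp only [mul_assoc]
    _ = _ := by rw [this]

/-- The endomorphism of `C(X) ⋊_φ ℤ` with `f ↦ f` for `f ∈ C(X)` and `U ↦ U e^{-itF}`. -/
def flowHom (t : ℝ) : CrossedProduct φ →⋆ₐ[ℂ] CrossedProduct φ :=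
  lift (isCovariant_twistedU φ F t)

theorem flowHom_ofFun (t : ℝ) (f : C(X, ℂ)) : flowHom φ F t (ofFun φ f) = ofFun φ f :=
  lift_ofFun _ f

theorem flowHom_U (t : ℝ) : flowHom φ F t (U φ : CrossedProduct φ) =
    (U φ : CrossedProduct φ) * ofFun φ (phase F t) := lift_U _

theorem flowHom_zero (a : CrossedProduct φ) : flowHom φ F 0 a = a := by
  have : flowHom φ F 0 = StarAlgHom.id ℂ _ := hom_ext (fun f => flowHom_ofFun φ F 0 f) (by
    rw [flowHom_U, phase_zero, map_one, mul_one]; rfl)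
  rw [this]
  rfl

theorem flowHom_add (s t : ℝ) (a : CrossedProduct φ) :
    flowHom φ F (s + t) a = flowHom φ F s (flowHom φ F t a) := by
  have : flowHom φ F (s + t) = (flowHom φ F s).comp (flowHom φ F t) := hom_ext
    (fun f => by simp only [StarAlgHom.comp_apply, flowHom_ofFun])
    (by rw [StarAlgHom.comp_apply, flowHom_U, flowHom_U, map_mul, flowHom_U, flowHom_ofFun,
      phase_add, map_mul, mul_assoc])
  rw [this]
  rfl

theorem continuous_flowHom (a : CrossedProduct φ) : Continuous fun t => flowHom φ F t a := by
  have hU : Continuous (twistedU φ F) := by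
    refine continuous_induced_rng.2 ?_
    change Continuous fun t => (U φ : CrossedProduct φ) * ofFun φ (phase F t)
    have : Continuous (ofFun φ) := (AddMonoidHomClass.lipschitz_of_bound (ofFun φ) 1
      fun f => by simpa using norm_ofFun_le f).continuous
    exact continuous_const.mul (this.comp (continuous_phase F))
  induction a using cp_induction with
  | hp =>
    rw [← isSeqClosed_iff_isClosed]
    intro x a hx ha
    refine continuous_of_uniform_approx_of_continuous fun u hu => ?_
    obtain ⟨ε, hε, hεu⟩ := Metric.mem_uniformity_dist.1 hu
    obtain ⟨n, hn⟩ := ((Metric.tendsto_nhds.1 ha) ε hε).exists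
    refine ⟨fun t => flowHom φ F t (x n), hx n, fun t => hεu ?_⟩
    rw [dist_eq_norm, ← map_sub]
    refine (NonUnitalStarAlgHom.norm_apply_le (flowHom φ F t) _).trans_lt ?_
    rwa [← dist_eq_norm, dist_comm]
  | h a =>
    induction a using alg_induction with
    | h0 => simpa using continuous_const
    | hs n f =>
      obtain ⟨f, rfl⟩ := toCoef_surjective f
      have h : ∀ t, flowHom φ F t (toCP φ (single n (toCoef φ f))) =
          ofFun φ f * ((twistedU φ F t ^ n.toAdd : unitary (CrossedProduct φ)) :
            CrossedProduct φ) := fun t => by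
        rw [hom_toCP_single _ (twistedU φ F t) (flowHom_U φ F t), flowHom_ofFun]
      simp only [h]
      exact continuous_const.mul (continuous_subtype_val.comp (hU.zpow n.toAdd))
    | ha a b h1 h2 =>
      simp only [map_add]
      exact h1.add h2

/-- The flow `α^F` on `C(X) ⋊_φ ℤ`: the one-parameter group of ⋆-automorphisms with
`α^F_t(f U) = f U e^{-itF}` for `f ∈ C(X)`. -/
def potentialFlow : CStarFlow (CrossedProduct φ) where
  aut t := StarAlgEquiv.ofStarAlgHom (flowHom φ F t) (flowHom φ F (-t))
    (by ext a; simp [← flowHom_add, flowHom_zero])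
    (by ext a; simp [← flowHom_add, flowHom_zero])
  aut_zero := flowHom_zero φ F
  aut_add := flowHom_add φ F
  continuous_aut := continuous_flowHom φ F

/-- The formula that determines the flow `α^F`. -/
theorem potentialFlow_ofFun_mul_U (t : ℝ) (f : C(X, ℂ)) :
    (potentialFlow φ F).aut t (ofFun φ f * (U φ : CrossedProduct φ)) =
      ofFun φ f * (U φ : CrossedProduct φ) * ofFun φ (phase F t) := by
  change flowHom φ F t _ = _
  rw [map_mul, flowHom_ofFun, flowHom_U, mul_assoc]

end Flows

end ZCrossedProduct

end

/-! If `α^F = Ad e^{itb}`, differentiating `e^{itb} U e^{-itb} = U e^{-itF}` at `t = 0` gives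
`F = b - U* b U`. The conditional expectation `E : ∑ fₙ Uⁿ ↦ f₀` onto `C(X)` satisfies
`E(U* b U) = E(b) ∘ φ`, so `F = E(b) - E(b) ∘ φ` and `h = -Re E(b)` solves `F = h ∘ φ - h`.
The bound `‖f₀‖ ≤ ‖∑ fₙ Uⁿ‖` that makes `E` well defined is read off the matrix coefficient at
`δ₀` of the representations on `ℓ²(ℤ)` along the orbits of `φ`. Conversely, if `F = h - h ∘ φ`,
then `Ad e^{ith}` fixes `C(X)` and maps `U` to `U e^{-itF}`, as `α^F_t` does. -/

noncomputable section

namespace ZCrossedProduct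

open SkewMonoidAlgebra
open scoped lp

theorem commutator_eq_of_exp_conj {A : Type*} [NormedRing A] [NormedAlgebra ℝ A] [CompleteSpace A]
    {x y u : A}
    (h : ∀ t : ℝ, NormedSpace.exp (t • x) * u * NormedSpace.exp (-(t • x)) =
      u * NormedSpace.exp (t • y)) :
    x * u - u * x = u * y := by
  have exp_deriv (z : A) : HasDerivAt (fun t : ℝ => NormedSpace.exp (t • z)) z 0 := by
    simpa using hasDerivAt_exp_smul_const (𝕂 := ℝ) z 0
  have left := ((exp_deriv x).mul_const u).mul (exp_deriv (-x))
  have right := (exp_deriv y).const_mul u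
  have := left.unique (right.congr_of_eventuallyEq (.of_forall fun t => by simpa using h t))
  simpa [sub_eq_add_neg] using this

section Representation

variable {ι : Type*}

/-- The permutation operator `(V y) i = y (e⁻¹ i)` on `ℓ²(ι)`. -/
def permIsometry (e : Equiv.Perm ι) : ℓ²(ι, ℂ) ≃ₗᵢ[ℂ] ℓ²(ι, ℂ) :=
  have h2 : 0 < (2 : ENNReal).toReal := by norm_num
  have memℓp_comp (e : Equiv.Perm ι) (y : ℓ²(ι, ℂ)) : Memℓp (fun i => y (e i)) 2 :=
    (memℓp_gen_iff h2).2 (e.summable_iff.2 ((memℓp_gen_iff h2).1 (lp.memℓp y)))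
  { toFun := fun y => ⟨fun i => y (e.symm i), memℓp_comp e.symm y⟩
    invFun := fun y => ⟨fun i => y (e i), memℓp_comp e y⟩
    left_inv := fun y => lp.ext (funext fun i => congrArg y (e.symm_apply_apply i))
    right_inv := fun y => lp.ext (funext fun i => congrArg y (e.apply_symm_apply i))
    map_add' := fun _ _ => rfl
    map_smul' := fun _ _ => rfl
    norm_map' := fun y => by
      rw [← Real.rpow_left_inj (norm_nonneg _) (norm_nonneg _) h2.ne',
        lp.norm_rpow_eq_tsum h2, lp.norm_rpow_eq_tsum h2]
      exact e.symm.tsum_eq fun i => ‖y i‖ ^ (2 : ENNReal).toReal }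

/-- The unitary representation of the permutations of `ι` on `ℓ²(ι)`. -/
def permUnitary : Equiv.Perm ι →* unitary (ℓ²(ι, ℂ) →L[ℂ] ℓ²(ι, ℂ)) where
  toFun e := Unitary.linearIsometryEquiv.symm (permIsometry e)
  map_one' := rfl
  map_mul' _ _ := rfl

theorem permUnitary_apply (e : Equiv.Perm ι) (y : ℓ²(ι, ℂ)) (i : ι) :
    (permUnitary e : ℓ²(ι, ℂ) →L[ℂ] ℓ²(ι, ℂ)) y i = y (e.symm i) := rfl

theorem star_permUnitary (e : Equiv.Perm ι) :
    star (permUnitary e : ℓ²(ι, ℂ) →L[ℂ] ℓ²(ι, ℂ)) = permUnitary e⁻¹ := by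
  rw [map_inv, ← Unitary.star_eq_inv, Unitary.coe_star]

variable {X : Type*} [TopologicalSpace X] [CompactSpace X]

/-- The representation of `C(X)` on `ℓ²(ι)` by the diagonal operators `f (s i)`. -/
def diagonalRep (s : ι → X) : C(X, ℂ) →⋆ₐ[ℂ] (ℓ²(ι, ℂ) →L[ℂ] ℓ²(ι, ℂ)) where
  toFun f := lp.mapCLM 2 (fun i => ContinuousLinearMap.mul ℂ ℂ (f (s i))) (norm_nonneg f)
    fun i => (ContinuousLinearMap.opNorm_mul_apply_le ℂ ℂ _).trans (f.norm_coe_le_norm _)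
  map_one' := ContinuousLinearMap.ext fun y => lp.ext (funext fun i => one_mul (y i))
  map_mul' f g := ContinuousLinearMap.ext fun y => lp.ext (funext fun i => mul_assoc _ _ _)
  map_zero' := ContinuousLinearMap.ext fun y => lp.ext (funext fun i => zero_mul (y i))
  map_add' f g := ContinuousLinearMap.ext fun y => lp.ext (funext fun i => add_mul _ _ _)
  commutes' c := by
    ext y i
    simp [Algebra.algebraMap_eq_smul_one]
  map_star' f := by
    refine (ContinuousLinearMap.eq_adjoint_iff _ _).2 fun y z => ?_
    rw [lp.inner_eq_tsum, lp.inner_eq_tsum]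
    refine tsum_congr fun i => ?_
    simp [mul_assoc, mul_left_comm]

theorem diagonalRep_apply (s : ι → X) (f : C(X, ℂ)) (y : ℓ²(ι, ℂ)) (i : ι) :
    diagonalRep s f y i = f (s i) * y i := rfl

variable {φ : X ≃ₜ X}

theorem isCovariant_diagonalRep {s : ι → X} {e : Equiv.Perm ι} (h : ∀ i, s (e i) = φ (s i)) :
    IsCovariant φ (diagonalRep s) (permUnitary e) := by
  intro f
  have s_symm (i : ι) : s (e.symm i) = φ.symm (s i) := by
    rw [φ.eq_symm_apply, ← h, e.apply_symm_apply]
  ext y i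
  rw [star_permUnitary, mul_apply_eq_comp, mul_apply_eq_comp, permUnitary_apply,
    diagonalRep_apply, permUnitary_apply, diagonalRep_apply, s_symm]
  exact congrArg (_ * y ·) (e.apply_symm_apply i)

theorem isCovariant_orbit (φ : X ≃ₜ X) (x : X) :
    IsCovariant φ (diagonalRep fun n : ℤ => (φ ^ n : X ≃ₜ X) x)
      (permUnitary (Equiv.addRight 1)) :=
  isCovariant_diagonalRep fun n => by
    change (φ ^ (n + 1) : X ≃ₜ X) x = φ ((φ ^ n : X ≃ₜ X) x)
    rw [add_comm, zpow_one_add]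
    rfl

end Representation

section Expectation

variable {X : Type*} [TopologicalSpace X] [CompactSpace X]

/-- The coefficient `f₀` of a finite sum `∑ fₙ Uⁿ`. -/
def zerothCoeff (φ : X ≃ₜ X) : Alg φ →ₗ[ℂ] C(X, ℂ) where
  toFun a := (toCoef φ).symm (a.coeff 1)
  map_add' a b := by rw [coeff_add, Finsupp.add_apply, map_add]
  map_smul' c a := by rw [coeff_smul, Finsupp.smul_apply, map_smul, RingHom.id_apply]

variable {φ : X ≃ₜ X}

theorem zerothCoeff_single_one (f : C(X, ℂ)) : zerothCoeff φ (single 1 (toCoef φ f)) = f := by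
  simp [zerothCoeff]

theorem zerothCoeff_single_of_ne {n : Multiplicative ℤ} (hn : n ≠ 1) (f : Coef φ) :
    zerothCoeff φ (single n f) = 0 := by
  simp [zerothCoeff, hn]

theorem liftAlg_orbit_single_zero (a : Alg φ) (x : X) :
    liftAlg (isCovariant_orbit φ x) a (lp.single 2 0 1) 0 = zerothCoeff φ a x := by
  induction a using alg_induction with
  | h0 => simp
  | ha a b iha ihb => simp [iha, ihb]
  | hs n f =>
    obtain ⟨f, rfl⟩ := toCoef_surjective f
    rw [liftAlg_single, mul_apply_eq_comp, diagonalRep_apply, ← map_zpow, permUnitary_apply]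
    by_cases hn : n = 1
    · simp [hn, zerothCoeff_single_one, Pi.single_apply, Equiv.symm_apply_eq]
    · have : n.toAdd ≠ 0 := by simpa
      simp [zerothCoeff_single_of_ne hn, this]

theorem norm_zerothCoeff_le (a : Alg φ) : ‖zerothCoeff φ a‖ ≤ ‖a‖ := by
  refine (ContinuousMap.norm_le _ (norm_nonneg a)).2 fun x => ?_
  calc ‖zerothCoeff φ a x‖
      = ‖liftAlg (isCovariant_orbit φ x) a (lp.single 2 0 1) 0‖ := by
        rw [liftAlg_orbit_single_zero]
    _ ≤ ‖liftAlg (isCovariant_orbit φ x) a (lp.single 2 0 1)‖ :=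
        lp.norm_apply_le_norm two_ne_zero _ _
    _ ≤ ‖liftAlg (isCovariant_orbit φ x) a‖ * ‖(lp.single 2 0 1 : ℓ²(ℤ, ℂ))‖ :=
        ContinuousLinearMap.le_opNorm _ _
    _ ≤ ‖a‖ := by
        rw [lp.norm_single two_pos, norm_one, mul_one]
        exact norm_liftAlg_le _ a

/-- The canonical conditional expectation of `C(X) ⋊_φ ℤ` onto `C(X)`, `∑ fₙ Uⁿ ↦ f₀`. -/
def expectation (φ : X ≃ₜ X) : CrossedProduct φ →L[ℂ] C(X, ℂ) :=
  (zerothCoeff φ).extendOfNorm (toCP φ).toLinearMap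

theorem expectation_toCP (a : Alg φ) : expectation φ (toCP φ a) = zerothCoeff φ a :=
  LinearMap.extendOfNorm_eq denseRange_toCP
    ⟨1, fun a => by simpa [norm_toCP] using norm_zerothCoeff_le a⟩ a

theorem expectation_ofFun (f : C(X, ℂ)) : expectation φ (ofFun φ f) = f := by
  rw [ofFun_apply, expectation_toCP, zerothCoeff_single_one]

theorem ofFun_mul_U (f : C(X, ℂ)) :
    ofFun φ f * (U φ : CrossedProduct φ) =
      (U φ : CrossedProduct φ) * ofFun φ (f.comp (φ : C(X, X))) := by
  have h := U_mul_ofFun_mul_star (φ := φ) (f.comp (φ : C(X, X)))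
  rw [ContinuousMap.comp_assoc, Homeomorph.toContinuousMap_comp_symm,
    ContinuousMap.comp_id] at h
  rw [← h, mul_assoc, Unitary.coe_star_mul_self, mul_one]

theorem star_U_mul_toCP_single_mul_U (n : Multiplicative ℤ) (f : C(X, ℂ)) :
    star (U φ : CrossedProduct φ) * toCP φ (single n (toCoef φ f)) * (U φ : CrossedProduct φ) =
      toCP φ (single n (toCoef φ (f.comp (φ : C(X, X))))) := by
  rw [toCP_single, toCP_single, mul_assoc, mul_assoc, ← Submonoid.coe_mul,
    ((Commute.refl (U φ)).zpow_left _).eq, Submonoid.coe_mul, ← mul_assoc (ofFun φ f), ofFun_mul_U,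
    mul_assoc, ← mul_assoc (star _), Unitary.coe_star_mul_self, one_mul]

theorem expectation_star_U_mul_mul_U (a : CrossedProduct φ) :
    expectation φ (star (U φ : CrossedProduct φ) * a * (U φ : CrossedProduct φ)) =
      (expectation φ a).comp (φ : C(X, X)) := by
  induction a using cp_induction with
  | hp => exact isClosed_eq (by fun_prop) (by fun_prop)
  | h a =>
    induction a using alg_induction with
    | h0 => simp
    | ha a b iha ihb => rw [map_add, mul_add, add_mul, map_add, iha, ihb, map_add]; rfl
    | hs n f =>
      obtain ⟨f, rfl⟩ := toCoef_surjective f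
      rw [star_U_mul_toCP_single_mul_U, expectation_toCP, expectation_toCP]
      by_cases hn : n = 1
      · rw [hn, zerothCoeff_single_one, zerothCoeff_single_one]
      · rw [zerothCoeff_single_of_ne hn, zerothCoeff_single_of_ne hn]
        rfl

end Expectation

section Potential

variable {X : Type*} [TopologicalSpace X] {F h : C(X, ℝ)}

theorem isSelfAdjoint_toComplex (h : C(X, ℝ)) : IsSelfAdjoint (toComplex h) :=
  ContinuousMap.ext fun x => Complex.conj_ofReal (h x)

theorem phase_comp_mul_phase {g : C(X, X)} (hF : ∀ x, F x = h x - h (g x)) (t : ℝ) :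
    (phase h (-t)).comp g * phase h t = phase F t := by
  ext x
  simp only [phase, ContinuousMap.coe_mk, ContinuousMap.mul_apply, ContinuousMap.comp_apply,
    ← Complex.exp_add, hF x]
  congr 1
  push_cast
  ring

variable [CompactSpace X] {φ : X ≃ₜ X}

theorem exp_toComplex (h : C(X, ℝ)) (t : ℝ) :
    NormedSpace.exp ((Complex.I * t) • toComplex h) = phase h (-t) := by
  ext x
  have map_exp := NormedSpace.map_exp (ContinuousMap.evalAlgHom ℂ ℂ x)
    (continuous_eval_const x) ((Complex.I * t) • toComplex h)
  refine map_exp.trans ?_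
  rw [← Complex.exp_eq_exp_ℂ]
  simp [toComplex, phase]

theorem continuous_ofFun (φ : X ≃ₜ X) : Continuous (ofFun φ) :=
  (AddMonoidHomClass.lipschitz_of_bound (ofFun φ) 1
    fun f => by simpa using norm_ofFun_le f).continuous

theorem exp_ofFun_toComplex (φ : X ≃ₜ X) (h : C(X, ℝ)) (t : ℝ) :
    NormedSpace.exp ((Complex.I * t) • ofFun φ (toComplex h)) = ofFun φ (phase h (-t)) := by
  let _ : NormedAlgebra ℚ (CrossedProduct φ) := NormedAlgebra.restrictScalars ℚ ℂ _
  rw [← map_smul, ← exp_toComplex]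
  exact (NormedSpace.map_exp (ofFun φ) (continuous_ofFun φ) _).symm

theorem exp_neg_ofFun_toComplex (φ : X ≃ₜ X) (h : C(X, ℝ)) (t : ℝ) :
    NormedSpace.exp (-((Complex.I * t) • ofFun φ (toComplex h))) = ofFun φ (phase h t) := by
  simpa using exp_ofFun_toComplex φ h (-t)

theorem commutator_U_of_implementedBy {b : CrossedProduct φ}
    (hb : (potentialFlow φ F).ImplementedBy b) :
    b * (U φ : CrossedProduct φ) - (U φ : CrossedProduct φ) * b =
      -((U φ : CrossedProduct φ) * ofFun φ (toComplex F)) := by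
  have real_smul (t : ℝ) (a : CrossedProduct φ) : t • (Complex.I • a) = (Complex.I * t) • a := by
    rw [mul_comm, mul_smul, Complex.coe_smul]
  have flow_U (t : ℝ) : NormedSpace.exp (t • (Complex.I • b)) * (U φ : CrossedProduct φ) *
      NormedSpace.exp (-(t • (Complex.I • b))) = (U φ : CrossedProduct φ) *
        NormedSpace.exp (t • -(Complex.I • ofFun φ (toComplex F))) := by
    rw [smul_neg, real_smul, real_smul, exp_neg_ofFun_toComplex, ← hb t]
    exact flowHom_U φ F t
  have key := commutator_eq_of_exp_conj flow_U
  refine smul_right_injective _ Complex.I_ne_zero ?_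
  simpa [smul_sub] using key

theorem coboundary_of_implementedBy {b : CrossedProduct φ}
    (hb : (potentialFlow φ F).ImplementedBy b) :
    toComplex F = expectation φ b - (expectation φ b).comp (φ : C(X, X)) := by
  have conj_sub : ofFun φ (toComplex F) =
      b - star (U φ : CrossedProduct φ) * b * (U φ : CrossedProduct φ) := by
    have := congrArg (star (U φ : CrossedProduct φ) * ·) (commutator_U_of_implementedBy hb)
    simp only [mul_sub, mul_neg, ← mul_assoc, Unitary.coe_star_mul_self, one_mul] at this
    rw [← neg_sub, this, neg_neg]
  rw [← expectation_star_U_mul_mul_U, ← map_sub, ← conj_sub, expectation_ofFun]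

theorem exists_coboundary_of_implementedBy {b : CrossedProduct φ}
    (hb : (potentialFlow φ F).ImplementedBy b) : ∃ h : C(X, ℝ), ∀ x, F x = h (φ x) - h x := by
  refine ⟨⟨fun x => -(expectation φ b x).re, by fun_prop⟩, fun x => ?_⟩
  have hF : F x = (expectation φ b x).re - (expectation φ b (φ x)).re :=
    congrArg Complex.re (DFunLike.congr_fun (coboundary_of_implementedBy hb) x)
  rw [hF]
  exact (neg_sub_neg _ _).symm

theorem implementedBy_ofFun_toComplex (hF : ∀ x, F x = h x - h (φ x)) :
    (potentialFlow φ F).ImplementedBy (ofFun φ (toComplex h)) := by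
  intro t a
  let ρ : CrossedProduct φ →⋆ₐ[ℂ] CrossedProduct φ :=
    (Unitary.conjStarAlgAut ℂ _ (unitaryMap (ofFun φ) (phaseUnitary h (-t)))).toStarAlgHom
  have ρ_apply (a : CrossedProduct φ) :
      ρ a = ofFun φ (phase h (-t)) * a * ofFun φ (phase h t) := by
    have star_phase_neg : star (ofFun φ (phase h (-t))) = ofFun φ (phase h t) := by
      rw [← map_star, star_phase, neg_neg]
    rw [← star_phase_neg]
    rfl
  have flowHom_eq : flowHom φ F t = ρ := by
    refine hom_ext (fun f => ?_) ?_
    · rw [ρ_apply, flowHom_ofFun, ← map_mul, ← map_mul, mul_right_comm, ← phase_add,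
        neg_add_cancel, phase_zero, one_mul]
    · rw [ρ_apply, flowHom_U, ofFun_mul_U, mul_assoc, ← map_mul,
        phase_comp_mul_phase (g := (φ : C(X, X))) hF]
  rw [exp_ofFun_toComplex, exp_neg_ofFun_toComplex, ← ρ_apply, ← flowHom_eq]
  rfl

end Potential

end ZCrossedProduct

end

theorem theorem2p1_general {X : Type*} [TopologicalSpace X] [CompactSpace X] (φ : X ≃ₜ X)
    (F : C(X, ℝ)) :
    List.TFAE [
      (ZCrossedProduct.potentialFlow φ F).IsInner,
      ∃ h : C(X, ℝ), (ZCrossedProduct.potentialFlow φ F).ImplementedBy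
        (ZCrossedProduct.ofFun φ (ZCrossedProduct.toComplex h)),
      ∃ h : C(X, ℝ), ∀ x, F x = h (φ x) - h x] := by
  tfae_have 1 → 3 := fun ⟨_, _, hb⟩ => ZCrossedProduct.exists_coboundary_of_implementedBy hb
  tfae_have 3 → 2 := fun ⟨h, hF⟩ =>
    ⟨-h, ZCrossedProduct.implementedBy_ofFun_toComplex fun x => (hF x).trans (neg_sub_neg _ _).symm⟩
  tfae_have 2 → 1 := fun ⟨h, hh⟩ =>
    ⟨_, (ZCrossedProduct.isSelfAdjoint_toComplex h).map (ZCrossedProduct.ofFun φ), hh⟩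
  tfae_finish

/-- For a homeomorphism `φ` of a compact metric space `X` and a real-valued `F ∈ C(X)`, the flow
`α^F` on `C(X) ⋊_φ ℤ` is inner iff it is `Ad e^{ith}` for a real-valued `h ∈ C(X)` iff
`F = h ∘ φ - h` for a continuous `h : X → ℝ`. -/
theorem theorem2p1 {X : Type*} [MetricSpace X] [CompactSpace X] (φ : X ≃ₜ X) (F : C(X, ℝ)) :
    List.TFAE [
      (ZCrossedProduct.potentialFlow φ F).IsInner,
      ∃ h : C(X, ℝ), (ZCrossedProduct.potentialFlow φ F).ImplementedBy
        (ZCrossedProduct.ofFun φ (ZCrossedProduct.toComplex h)),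
      ∃ h : C(X, ℝ), ∀ x, F x = h (φ x) - h x] :=
  theorem2p1_general φ F
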